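/- Let $R$ be a commutative ring with a derivation $a\mapsto a'$; $R[\partial;']$ denotes the ring of differential polynomials $\sum_i a_i\partial^i$ ($a_i\in R$) with multiplication determined by $\partial a=a\partial+a'$. We use $R=\mathbb{R}[t]$ and $R=\mathbb{R}(t)$ with $'=d/dt$, and regard $\mathbb{R}[t][\partial;']\subset\mathbb{R}(t)[\partial;']$. For nonzero $f,g\in\mathbb{R}(t)[\partial;']$, a greatest common right divisor $\operatorname{gcrd}(f,g)$ is an $h\in\mathbb{R}(t)[\partial;']$ of maximal degree in $\partial$ among those with $f=uh$ and $g=vh$ for some $u,v\in\mathbb{R}(t)[\partial;']$. Let $f,g\in\mathbb{R}[t][\partial;']$ be nonzero with $\deg_\partial f=m$, $\deg_\partial g=n$, whose coefficients all have degree at most $d$ in $t$. Let $V=V(f,g)\in\mathbb{R}[t]^{(m+n)\times(m+n)}$ be the differential Sylvester matrix, whose rows are the coefficient vectors (coefficients of $\partial^0,\dots,\partial^{m+n-1}$) of $f,\partial f,\dots,\partial^{n-1}f,g,\partial g,\dots,\partial^{m-1}g$, in this order. Then a greatest common right divisor of $f$ and $g$ exists, and for any such $\operatorname{gcrd}(f,g)$: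 1. $V$ is singular (i.e. $\det V=0$) if and only if $\deg_\partial\operatorname{gcrd}(f,g)\ge 1$. 2. $\deg_\partial\operatorname{gcrd}(f,g)=\dim_{\mathbb{R}(t)}\{w\in\mathbb{R}(t)^{1\times(m+n)} : wV=0\}$. 3. For every $w=(u_0,\dots,u_{n-1},v_0,\dots,v_{m-1})\in\mathbb{R}(t)^{1\times(m+n)}$ with $wV=0$ we have $uf+vg=0$, where $u=\sum_{0\le i<n}u_i\partial^i$ and $v=\sum_{0\le i<m}v_i\partial^i$. 4. If $\deg_\partial\operatorname{gcrd}(f,g)\ge1$, then there is a nonzero $w\in\mathbb{R}[t]^{1\times(m+n)}$ with $wV=0$ all of whose entries have degree at most $2(m+n)d$ in $t$. -/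

import Mathlib

open Polynomial
open scoped Differential

noncomputable section

/-- An additive map that satisfies the Leibniz rule makes `R` a differential ring. -/
@[reducible]
def Differential.ofLeibniz {R : Type*} [CommRing R] (δ : R → R)
    (hadd : ∀ x y, δ (x + y) = δ x + δ y) (hmul : ∀ x y, δ (x * y) = x * δ y + y * δ x) :
    Differential R :=
  ⟨Derivation.mk' (AddMonoidHom.mk' δ hadd).toIntLinearMap hmul⟩

/-- `F[t]` with the usual derivation `d/dt`. -/
instance polynomialDifferential (F : Type*) [Field F] : Differential F[X] :=
  ⟨Polynomial.derivative'.restrictScalars ℤ⟩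

namespace RatFuncDeriv

variable {F : Type*} [Field F]

/-- The quotient rule, applied to the reduced fraction `num / denom`. -/
def fn (x : RatFunc F) : RatFunc F :=
  (algebraMap F[X] (RatFunc F) (derivative x.num) * algebraMap F[X] (RatFunc F) x.denom -
      algebraMap F[X] (RatFunc F) x.num * algebraMap F[X] (RatFunc F) (derivative x.denom)) /
    algebraMap F[X] (RatFunc F) x.denom ^ 2

theorem fn_div (p q : F[X]) (hq : q ≠ 0) :
    fn (algebraMap F[X] (RatFunc F) p / algebraMap F[X] (RatFunc F) q) =
      (algebraMap F[X] (RatFunc F) (derivative p) * algebraMap F[X] (RatFunc F) q -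
        algebraMap F[X] (RatFunc F) p * algebraMap F[X] (RatFunc F) (derivative q)) /
      algebraMap F[X] (RatFunc F) q ^ 2 := by
  set x : RatFunc F := algebraMap F[X] (RatFunc F) p / algebraMap F[X] (RatFunc F) q with hx
  have hd : x.denom ≠ 0 := x.denom_ne_zero
  have hq' : algebraMap F[X] (RatFunc F) q ≠ 0 := RatFunc.algebraMap_ne_zero hq
  have hd' : algebraMap F[X] (RatFunc F) x.denom ≠ 0 := RatFunc.algebraMap_ne_zero hd
  have h1 : x.num * q = p * x.denom := by
    apply RatFunc.algebraMap_injective F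
    have h := x.num_div_denom
    rw [map_mul, map_mul]
    rw [hx, ← hx, div_eq_div_iff hd' hq'] at h
    exact h
  have h2 := congrArg (algebraMap F[X] (RatFunc F)) (congrArg derivative h1)
  have h1' := congrArg (algebraMap F[X] (RatFunc F)) h1
  simp only [derivative_mul, map_add, map_mul] at h1' h2
  rw [fn, div_eq_div_iff (pow_ne_zero 2 hd') (pow_ne_zero 2 hq')]
  generalize algebraMap F[X] (RatFunc F) x.num = a at *
  generalize algebraMap F[X] (RatFunc F) x.denom = b at *
  generalize algebraMap F[X] (RatFunc F) (derivative x.num) = a' at *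
  generalize algebraMap F[X] (RatFunc F) (derivative x.denom) = b' at *
  generalize algebraMap F[X] (RatFunc F) (derivative p) = p' at *
  generalize algebraMap F[X] (RatFunc F) (derivative q) = q' at *
  generalize algebraMap F[X] (RatFunc F) p = P at *
  generalize algebraMap F[X] (RatFunc F) q = Q at *
  linear_combination (b * Q) * h2 - (b' * Q + b * q') * h1'

theorem exists_div (x : RatFunc F) : ∃ p q : F[X], q ≠ 0 ∧
    x = algebraMap F[X] (RatFunc F) p / algebraMap F[X] (RatFunc F) q :=
  ⟨x.num, x.denom, x.denom_ne_zero, x.num_div_denom.symm⟩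

theorem fn_add (x y : RatFunc F) : fn (x + y) = fn x + fn y := by
  obtain ⟨p, q, hq, rfl⟩ := exists_div x
  obtain ⟨r, s, hs, rfl⟩ := exists_div y
  have hq' : algebraMap F[X] (RatFunc F) q ≠ 0 := RatFunc.algebraMap_ne_zero hq
  have hs' : algebraMap F[X] (RatFunc F) s ≠ 0 := RatFunc.algebraMap_ne_zero hs
  rw [div_add_div _ _ hq' hs', ← map_mul, ← map_mul, ← map_mul, ← map_add,
    fn_div _ _ (mul_ne_zero hq hs), fn_div _ _ hq, fn_div _ _ hs]
  simp only [derivative_mul, map_add, map_mul]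
  field_simp
  ring

theorem fn_mul (x y : RatFunc F) : fn (x * y) = x * fn y + y * fn x := by
  obtain ⟨p, q, hq, rfl⟩ := exists_div x
  obtain ⟨r, s, hs, rfl⟩ := exists_div y
  have hq' : algebraMap F[X] (RatFunc F) q ≠ 0 := RatFunc.algebraMap_ne_zero hq
  have hs' : algebraMap F[X] (RatFunc F) s ≠ 0 := RatFunc.algebraMap_ne_zero hs
  rw [div_mul_div_comm, ← map_mul, ← map_mul,
    fn_div _ _ (mul_ne_zero hq hs), fn_div _ _ hq, fn_div _ _ hs]
  simp only [derivative_mul, map_add, map_mul]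
  field_simp
  ring

end RatFuncDeriv

/-- `F(t)` with the usual derivation `d/dt`. -/
instance ratFuncDifferential (F : Type*) [Field F] : Differential (RatFunc F) :=
  Differential.ofLeibniz RatFuncDeriv.fn RatFuncDeriv.fn_add RatFuncDeriv.fn_mul

/-- The ring `R[∂;′]` of differential polynomials over a differential ring `R`. Its elements are
finite sums `∑ aᵢ ∂ⁱ` with coefficients written on the left, stored as the polynomial `∑ aᵢ Xⁱ`.
The multiplication, defined below, is not that of `R[X]`. -/
def DiffOp (R : Type*) [CommRing R] : Type _ := R[X]

namespace DiffOp

variable {R : Type*} [CommRing R]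

instance : AddCommGroup (DiffOp R) := inferInstanceAs (AddCommGroup R[X])

/-- The coefficient of `∂ⁱ`. -/
def coeff (f : DiffOp R) (i : ℕ) : R := Polynomial.coeff (R := R) f i

/-- The degree in `∂` (with value `⊥` at `0`). -/
def degree (f : DiffOp R) : WithBot ℕ := Polynomial.degree (R := R) f

/-- An element of `R` as a differential polynomial of order zero. -/
def C (a : R) : DiffOp R := (Polynomial.C a : R[X])

variable (R) in
/-- The symbol `∂`. -/
def D : DiffOp R := (Polynomial.X : R[X])

/-- Coefficientwise image under a ring homomorphism. -/
def map {S : Type*} [CommRing S] (φ : R →+* S) (f : DiffOp R) : DiffOp S :=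
  Polynomial.map (R := R) φ f

variable [Differential R]

/-- Left multiplication by `∂`: since `∂ a = a ∂ + a′`, it sends
`∑ aⱼ ∂ʲ` to `∑ aⱼ ∂ʲ⁺¹ + ∑ aⱼ′ ∂ʲ`. -/
def dMul : R[X] →+ R[X] :=
  AddMonoidHom.mk' (fun g => X * g + g.sum fun j a => monomial j (a′)) (by
    intro p q
    rw [sum_add_index _ _ _ (by simp) (by simp), mul_add]
    abel)

/-- The product `(∑ aᵢ ∂ⁱ) g = ∑ aᵢ (∂ⁱ g)`. -/
def mulFn (f g : R[X]) : R[X] :=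
  f.sum fun i a => Polynomial.C a * dMul^[i] g

theorem mulFn_monomial (i : ℕ) (a : R) (g : R[X]) :
    mulFn (monomial i a) g = Polynomial.C a * dMul^[i] g := by
  simp [mulFn, sum_monomial_index]

theorem mulFn_add_left (f₁ f₂ g : R[X]) : mulFn (f₁ + f₂) g = mulFn f₁ g + mulFn f₂ g := by
  unfold mulFn
  rw [sum_add_index] <;> simp [add_mul]

theorem mulFn_add_right (f g₁ g₂ : R[X]) : mulFn f (g₁ + g₂) = mulFn f g₁ + mulFn f g₂ := by
  simp only [mulFn, Polynomial.sum, iterate_map_add, mul_add, Finset.sum_add_distrib]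

theorem mulFn_zero_left (g : R[X]) : mulFn 0 g = 0 := by simp [mulFn]

theorem mulFn_zero_right (f : R[X]) : mulFn f 0 = 0 := by
  simp [mulFn, Polynomial.sum, iterate_map_zero]

theorem mulFn_C_mul (a : R) (g h : R[X]) :
    mulFn (Polynomial.C a * g) h = Polynomial.C a * mulFn g h := by
  induction g using Polynomial.induction_on' with
  | add p q hp hq => rw [mul_add, mulFn_add_left, mulFn_add_left, hp, hq, mul_add]
  | monomial i b => rw [C_mul_monomial, mulFn_monomial, mulFn_monomial, C_mul, mul_assoc]

theorem dMul_monomial (i : ℕ) (a : R) :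
    dMul (monomial i a) = monomial (i + 1) a + monomial i (a′) := by
  simp [dMul, sum_monomial_index, X_mul_monomial]

theorem dMul_C_mul (a : R) (g : R[X]) :
    dMul (Polynomial.C a * g) = Polynomial.C a * dMul g + Polynomial.C (a′) * g := by
  induction g using Polynomial.induction_on' with
  | add p q hp hq => rw [mul_add, map_add, hp, hq, map_add]; ring
  | monomial i b =>
    simp only [C_mul_monomial, dMul_monomial, mul_add, Derivation.leibniz, smul_eq_mul, map_add]
    rw [mul_comm b, add_assoc]

theorem mulFn_dMul (g h : R[X]) : mulFn (dMul g) h = dMul (mulFn g h) := by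
  induction g using Polynomial.induction_on' with
  | add p q hp hq => rw [map_add, mulFn_add_left, mulFn_add_left, hp, hq, map_add]
  | monomial i b =>
    rw [dMul_monomial, mulFn_add_left, mulFn_monomial, mulFn_monomial, mulFn_monomial,
      dMul_C_mul, Function.iterate_succ_apply']

theorem mulFn_assoc (f g h : R[X]) : mulFn (mulFn f g) h = mulFn f (mulFn g h) := by
  induction f using Polynomial.induction_on' with
  | add p q hp hq => rw [mulFn_add_left, mulFn_add_left, mulFn_add_left, hp, hq]
  | monomial i b =>
    rw [mulFn_monomial, mulFn_monomial, mulFn_C_mul]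
    congr 1
    induction i with
    | zero => rfl
    | succ i ih => rw [Function.iterate_succ_apply', Function.iterate_succ_apply', mulFn_dMul, ih]

theorem mulFn_one_left (g : R[X]) : mulFn 1 g = g := by
  rw [← monomial_zero_one, mulFn_monomial]
  simp

theorem dMul_iterate_one (i : ℕ) : dMul^[i] (1 : R[X]) = monomial i 1 := by
  induction i with
  | zero => simp
  | succ i ih =>
    rw [Function.iterate_succ_apply', ih, dMul_monomial, Derivation.map_one_eq_zero]
    simp

theorem mulFn_one_right (f : R[X]) : mulFn f 1 = f := by
  induction f using Polynomial.induction_on' with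
  | add p q hp hq => rw [mulFn_add_left, hp, hq]
  | monomial i b => rw [mulFn_monomial, dMul_iterate_one, C_mul_monomial, mul_one]

instance : Ring (DiffOp R) :=
  { (inferInstance : AddCommGroup (DiffOp R)) with
    mul := fun f g => mulFn f g
    one := (1 : R[X])
    mul_assoc := mulFn_assoc
    one_mul := mulFn_one_left
    mul_one := mulFn_one_right
    zero_mul := mulFn_zero_left
    mul_zero := mulFn_zero_right
    left_distrib := mulFn_add_right
    right_distrib := mulFn_add_left }

/-- `h` divides `f` on the right. -/
def RightDvd (h f : DiffOp R) : Prop := ∃ u : DiffOp R, f = u * h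

/-- `h` is a greatest common right divisor of `f` and `g`: a common right divisor of maximal
degree in `∂`. -/
def IsGCRD (f g h : DiffOp R) : Prop :=
  RightDvd h f ∧ RightDvd h g ∧
    ∀ k : DiffOp R, RightDvd k f → RightDvd k g → degree k ≤ degree h

/-- The vector `(f₀, …, f_{ℓ-1})` of the first `ℓ` coefficients. -/
def coeffVec (ℓ : ℕ) (f : DiffOp R) : Fin ℓ → R := fun j => f.coeff j

/-- The differential Sylvester matrix of `f` and `g`, of degrees `m` and `n` in `∂`: its rows are
the coefficient vectors of `f, ∂f, …, ∂ⁿ⁻¹f, g, ∂g, …, ∂ᵐ⁻¹g`. -/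
def sylvester (m n : ℕ) (f g : DiffOp R) : Matrix (Fin (n + m)) (Fin (n + m)) R :=
  Matrix.of (Fin.append
    (fun i : Fin n => coeffVec (n + m) (D R ^ (i : ℕ) * f))
    (fun i : Fin m => coeffVec (n + m) (D R ^ (i : ℕ) * g)))

/-- The differential polynomial `∑ aᵢ ∂ⁱ` with the given coefficients. -/
def ofCoeffs {k : ℕ} (a : Fin k → R) : DiffOp R := ∑ i, C (a i) * D R ^ (i : ℕ)

end DiffOp

/-- The inclusion of `ℝ[t][∂;′]` in `ℝ(t)[∂;′]`. -/
def toRatOp (f : DiffOp ℝ[X]) : DiffOp (RatFunc ℝ) :=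
  DiffOp.map (algebraMap ℝ[X] (RatFunc ℝ)) f

/-- The left nullspace `{w : w A = 0}` of a matrix. -/
def leftNullspace {K ι κ : Type*} [Field K] [Fintype ι] (A : Matrix ι κ K) :
    Submodule K (ι → K) :=
  LinearMap.ker A.vecMulLinear

end

namespace DiffOp

/-! ### Degrees and coefficients of products. -/

section CommRing

variable {R : Type*} [CommRing R] [Differential R]

/-! Let `K` be the field of rational functions. In coefficients, `w ↦ wV` is the `K`-linear map `(u,
v) ↦ uf + vg` on operators with `deg u < n`, `deg v < m` (`sylvesterMap`). The values have degree
below `m + n`, so no coefficient is cut off and the left nullspace of `V` is the kernel of this map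
(`sylvesterMap_eq_zero_iff`); this already gives the relation `uf + vg = 0`.

Division with remainder yields a common right divisor `h = af + bg` (`exists_bezout`), and every
greatest common right divisor has the same degree `e` as `h`. The heart is `range_sylvesterMap`: the
range consists exactly of the multiples `ph` with `deg p < m + n - e`. It has dimension `m + n - e`,
so by rank-nullity the kernel has dimension `e`. Singularity of `V` is then the case `e ≥ 1`.

The degree bound is separate: applying `∂` does not raise degrees in `t`, so the entries of `V` have
degree at most `d`, and counting unknowns against equations over the constants gives a small null
vector (`exists_vecMul_eq_zero_natDegree_le`). -/

theorem coeff_dMul (g : R[X]) (j : ℕ) :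
    (dMul g).coeff j = (X * g).coeff j + (g.coeff j)′ := by
  induction g using Polynomial.induction_on' with
  | add p q hp hq => simp only [map_add, mul_add, coeff_add, hp, hq]; abel
  | monomial i a =>
    rw [dMul_monomial, coeff_add, X_mul_monomial, coeff_monomial (n := i) (m := j),
      coeff_monomial (n := i) (m := j)]
    split_ifs <;> simp

theorem coeff_dMul_zero (g : R[X]) : (dMul g).coeff 0 = (g.coeff 0)′ := by
  simp [coeff_dMul]

theorem coeff_dMul_succ (g : R[X]) (j : ℕ) :
    (dMul g).coeff (j + 1) = g.coeff j + (g.coeff (j + 1))′ := by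
  simp [coeff_dMul]

/-- Each `∂` shifts the top coefficient up unchanged; derivatives enter only in lower positions. -/
theorem natDegree_dMul_iterate_le (i : ℕ) (g : R[X]) {N : ℕ} (hg : g.natDegree ≤ N) :
    (dMul^[i] g).natDegree ≤ i + N ∧ (dMul^[i] g).coeff (i + N) = g.coeff N := by
  induction i with
  | zero => simpa using hg
  | succ i ih =>
    have hz : ∀ k, i + N < k → (dMul^[i] g).coeff k = 0 := fun k hk =>
      coeff_eq_zero_of_natDegree_lt (ih.1.trans_lt hk)
    rw [Function.iterate_succ_apply']
    refine ⟨natDegree_le_iff_coeff_eq_zero.2 fun k hk => ?_, ?_⟩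
    · obtain ⟨k, rfl⟩ : ∃ l, k = l + 1 := ⟨k - 1, by omega⟩
      rw [coeff_dMul_succ, hz _ (by omega), hz _ (by omega), map_zero, add_zero]
    · rw [show i + 1 + N = i + N + 1 by ring, coeff_dMul_succ, ih.2,
        hz (i + N + 1) (by omega), map_zero, add_zero]

theorem degree_dMul_iterate (i : ℕ) (g : R[X]) :
    (dMul^[i] g).degree = i + g.degree := by
  by_cases hg : g = 0
  · simp [hg, iterate_map_zero]
  · obtain ⟨h1, h2⟩ := natDegree_dMul_iterate_le i g le_rfl
    have h3 : (dMul^[i] g).coeff (i + g.natDegree) ≠ 0 := by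
      rw [h2]; simpa using hg
    rw [degree_eq_natDegree hg, ← Nat.cast_add]
    exact le_antisymm (natDegree_le_iff_degree_le.1 h1) (le_degree_of_ne_zero h3)

theorem leadingCoeff_dMul_iterate (i : ℕ) (g : R[X]) :
    (dMul^[i] g).leadingCoeff = g.leadingCoeff := by
  by_cases hg : g = 0
  · simp [hg, iterate_map_zero]
  · rw [leadingCoeff, natDegree_eq_of_degree_eq_some (n := i + g.natDegree),
      (natDegree_dMul_iterate_le i g le_rfl).2]
    · rfl
    · rw [degree_dMul_iterate, degree_eq_natDegree hg, Nat.cast_add]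

/-- Commuting `∂` past a coefficient only produces lower-order terms, so the leading coefficients
multiply as in `R[X]`. The induction peels off the leading term of `f`. -/
theorem degree_mulFn [IsDomain R] (f g : R[X]) :
    (mulFn f g).degree = f.degree + g.degree := by
  by_cases hg : g = 0
  · simp [hg, mulFn_zero_right]
  induction hN : f.natDegree using Nat.strong_induction_on generalizing f with
  | _ N ih =>
    by_cases hf : f = 0
    · simp [hf, mulFn_zero_left]
    have hmon : (mulFn (monomial f.natDegree f.leadingCoeff) g).degree =
        f.degree + g.degree := by
      rw [mulFn_monomial, degree_mul, degree_C (leadingCoeff_ne_zero.2 hf), zero_add,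
        degree_dMul_iterate, degree_eq_natDegree hf]
    conv_lhs => rw [← f.eraseLead_add_monomial_natDegree_leadingCoeff, mulFn_add_left]
    rw [degree_add_eq_right_of_degree_lt, hmon]
    rw [hmon]
    by_cases he : f.eraseLead = 0
    · rw [he, mulFn_zero_left, degree_zero, bot_lt_iff_ne_bot]
      simp [hf, hg]
    · have hlt := degree_eraseLead_lt hf
      rw [ih _ (hN ▸ natDegree_lt_natDegree he hlt) _ rfl]
      exact WithBot.add_lt_add_right (by simpa using hg) hlt

theorem mulFn_eq_zero [IsDomain R] {f g : R[X]} : mulFn f g = 0 ↔ f = 0 ∨ g = 0 := by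
  rw [← degree_eq_bot, degree_mulFn, WithBot.add_eq_bot, degree_eq_bot, degree_eq_bot]

/-- Right multiplication by a differential polynomial, as an `R`-linear map. -/
noncomputable def mulRight (g : R[X]) : R[X] →ₗ[R] R[X] where
  toFun f := mulFn f g
  map_add' f₁ f₂ := mulFn_add_left f₁ f₂ g
  map_smul' a f := by simp only [smul_eq_C_mul, mulFn_C_mul, RingHom.id_apply]

@[simp]
theorem mulRight_apply (f g : R[X]) : mulRight g f = mulFn f g := rfl

theorem mulRight_injective [IsDomain R] {g : R[X]} (hg : g ≠ 0) :
    Function.Injective (mulRight g) :=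
  (injective_iff_map_eq_zero _).2 fun _ hf => (mulFn_eq_zero.1 hf).resolve_right hg

theorem mulFn_sub_left (f₁ f₂ g : R[X]) : mulFn (f₁ - f₂) g = mulFn f₁ g - mulFn f₂ g :=
  map_sub (mulRight g) f₁ f₂

theorem D_pow_mul (i : ℕ) (g : DiffOp R) :
    D R ^ i * g = (dMul^[i] (show R[X] from g) : R[X]) := by
  induction i with
  | zero => rw [pow_zero, one_mul]; rfl
  | succ i ih =>
    rw [pow_succ', mul_assoc, ih, Function.iterate_succ_apply']
    change mulFn X _ = _
    rw [← monomial_one_one_eq_X, mulFn_monomial]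
    simp

theorem ofCoeffs_eq {k : ℕ} (a : Fin k → R) :
    ofCoeffs a = (((degreeLTEquiv R k).symm a : degreeLT R k) : R[X]) := by
  change ∑ i, C (a i) * D R ^ (i : ℕ) =
    ∑ i : Fin k, monomial (i : ℕ) (a i)
  refine Finset.sum_congr rfl fun i _ => ?_
  rw [← mul_one (D R ^ (i : ℕ)), D_pow_mul]
  change mulFn (Polynomial.C (a i)) (dMul^[i] (1 : R[X])) = _
  rw [← monomial_zero_left, mulFn_monomial, dMul_iterate_one, Function.iterate_zero, id,
    C_mul_monomial, mul_one]

end CommRing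

/-! ### Right division and Bézout relations over a differential field. -/

section Field

variable {K : Type*} [Field K] [Differential K]

theorem exists_mulFn_add_eq (f : K[X]) {g : K[X]} (hg : g ≠ 0) :
    ∃ q r : K[X], f = mulFn q g + r ∧ r.degree < g.degree := by
  induction hd : f.degree using WellFoundedLT.induction generalizing f with
  | _ N ih =>
    by_cases hlt : f.degree < g.degree
    · exact ⟨0, f, by rw [mulFn_zero_left, zero_add], hlt⟩
    have hle := not_lt.1 hlt
    have hf : f ≠ 0 := by
      rintro rfl
      exact hg (degree_eq_bot.1 (le_bot_iff.1 hle))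
    have hk : f.natDegree - g.natDegree + g.natDegree = f.natDegree :=
      Nat.sub_add_cancel (natDegree_le_natDegree hle)
    -- No twist of the quotient is needed: powers of `∂` preserve the leading coefficient of `g`.
    set q := monomial (f.natDegree - g.natDegree) (f.leadingCoeff / g.leadingCoeff) with hq
    have hne : f.leadingCoeff / g.leadingCoeff ≠ 0 :=
      div_ne_zero (leadingCoeff_ne_zero.2 hf) (leadingCoeff_ne_zero.2 hg)
    have hdeg : f.degree = (mulFn q g).degree := by
      rw [degree_mulFn, degree_monomial _ hne, degree_eq_natDegree hg, degree_eq_natDegree hf,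
        ← Nat.cast_add, hk]
    have hlc : f.leadingCoeff = (mulFn q g).leadingCoeff := by
      rw [hq, mulFn_monomial, leadingCoeff_mul, leadingCoeff_C, leadingCoeff_dMul_iterate,
        div_mul_cancel₀ _ (leadingCoeff_ne_zero.2 hg)]
    obtain ⟨q', r, hr, hrd⟩ := ih _ (hd ▸ degree_sub_lt_left hdeg hf hlc) (f - mulFn q g) rfl
    exact ⟨q + q', r, by rw [mulFn_add_left, add_assoc, ← hr, add_sub_cancel], hrd⟩

/-- A nonzero element of least degree in the left ideal generated by `f` and `g` divides the whole
ideal, since remainders stay in it. -/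
theorem exists_bezout {f : K[X]} (hf : f ≠ 0) (g : K[X]) :
    ∃ h a b : K[X], h ≠ 0 ∧ h = mulFn a f + mulFn b g ∧
      (∃ u, f = mulFn u h) ∧ ∃ v, g = mulFn v h := by
  let I : Submodule K K[X] := LinearMap.range (mulRight f) ⊔ LinearMap.range (mulRight g)
  have hI : ∀ p, p ∈ I ↔ ∃ a b, p = mulFn a f + mulFn b g := by
    intro p
    simp only [I, Submodule.mem_sup, LinearMap.mem_range, mulRight_apply]
    constructor
    · rintro ⟨_, ⟨a, rfl⟩, _, ⟨b, rfl⟩, rfl⟩; exact ⟨a, b, rfl⟩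
    · rintro ⟨a, b, rfl⟩; exact ⟨_, ⟨a, rfl⟩, _, ⟨b, rfl⟩, rfl⟩
  have hfI : f ∈ I := (hI f).2 ⟨1, 0, by rw [mulFn_one_left, mulFn_zero_left, add_zero]⟩
  have hgI : g ∈ I := (hI g).2 ⟨0, 1, by rw [mulFn_one_left, mulFn_zero_left, zero_add]⟩
  obtain ⟨h, ⟨hhI, hh⟩, hmin⟩ := exists_minimalFor_of_wellFoundedLT
    (fun p : K[X] => p ∈ I ∧ p ≠ 0) degree ⟨f, hfI, hf⟩
  obtain ⟨a, b, hab⟩ := (hI h).1 hhI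
  have hdvd : ∀ p ∈ I, ∃ u, p = mulFn u h := by
    intro p hp
    obtain ⟨q, r, hqr, hr⟩ := exists_mulFn_add_eq p hh
    refine ⟨q, ?_⟩
    have hrI : r ∈ I := by
      have : r = p - mulFn q h := by rw [hqr, add_sub_cancel_left]
      rw [this]
      refine I.sub_mem hp ((hI _).2 ⟨mulFn q a, mulFn q b, ?_⟩)
      rw [mulFn_assoc, mulFn_assoc, ← mulFn_add_right, ← hab]
    have hr0 : r = 0 := by
      by_contra hr0
      exact absurd (hmin ⟨hrI, hr0⟩ hr.le) (not_le.2 hr)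
    rw [hqr, hr0, add_zero]
  exact ⟨h, a, b, hh, hab, hdvd f hfI, hdvd g hgI⟩

end Field

end DiffOp

namespace DiffOp

/-! ### Operators of bounded degree as coefficient vectors. -/

section OfFinCoeffs

variable {R : Type*} [CommRing R]

/-- The ordinary polynomial with the same coefficients. -/
def toPolynomial (f : DiffOp R) : R[X] := f

theorem ne_zero_of_degree_eq {f : DiffOp R} {m : ℕ} (hf : f.degree = m) : f ≠ 0 := by
  rintro rfl
  exact absurd (degree_zero.symm.trans hf) (WithBot.bot_ne_natCast m)

variable (R) in
/-- The polynomial `∑ aᵢ Xⁱ`, linearly in the coefficient vector. -/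
noncomputable def ofFinCoeffs (k : ℕ) : (Fin k → R) →ₗ[R] R[X] :=
  (degreeLT R k).subtype ∘ₗ (degreeLTEquiv R k).symm.toLinearMap

theorem ofFinCoeffs_apply {k : ℕ} (a : Fin k → R) :
    ofFinCoeffs R k a = ∑ i : Fin k, monomial (i : ℕ) (a i) := rfl

theorem ofFinCoeffs_injective (k : ℕ) : Function.Injective (ofFinCoeffs R k) :=
  Subtype.val_injective.comp (degreeLTEquiv R k).symm.injective

theorem degree_ofFinCoeffs_lt {k : ℕ} (a : Fin k → R) : (ofFinCoeffs R k a).degree < k :=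
  mem_degreeLT.1 ((degreeLTEquiv R k).symm a).2

theorem exists_ofFinCoeffs_eq {k : ℕ} {p : R[X]} (hp : p.degree < k) :
    ∃ a, ofFinCoeffs R k a = p :=
  ⟨degreeLTEquiv R k ⟨p, mem_degreeLT.2 hp⟩, by simp [ofFinCoeffs]⟩

end OfFinCoeffs

/-! ### The Sylvester matrix as a linear map. -/

section CommRing

variable {R : Type*} [CommRing R] [Differential R]

/-- The map `(u, v) ↦ u f + v g`, where `u` and `v` are given by the vectors of their coefficients
of `∂⁰, …, ∂ⁿ⁻¹` and `∂⁰, …, ∂ᵐ⁻¹`. -/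
noncomputable def sylvesterMap (m n : ℕ) (f g : R[X]) : (Fin (n + m) → R) →ₗ[R] R[X] :=
  mulRight f ∘ₗ ofFinCoeffs R n ∘ₗ LinearMap.funLeft R R (Fin.castAdd m) +
    mulRight g ∘ₗ ofFinCoeffs R m ∘ₗ LinearMap.funLeft R R (Fin.natAdd n)

theorem sylvesterMap_apply (m n : ℕ) (f g : R[X]) (w : Fin (n + m) → R) :
    sylvesterMap m n f g w =
      mulFn (ofFinCoeffs R n fun i => w (Fin.castAdd m i)) f +
        mulFn (ofFinCoeffs R m fun i => w (Fin.natAdd n i)) g := rfl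

theorem sylvesterMap_append (m n : ℕ) (f g : R[X]) (a : Fin n → R) (b : Fin m → R) :
    sylvesterMap m n f g (Fin.append a b) =
      mulFn (ofFinCoeffs R n a) f + mulFn (ofFinCoeffs R m b) g := by
  simp only [sylvesterMap_apply, Fin.append_left, Fin.append_right]

theorem coeff_mulFn_ofFinCoeffs {k : ℕ} (a : Fin k → R) (f : R[X]) (j : ℕ) :
    (mulFn (ofFinCoeffs R k a) f).coeff j = ∑ i : Fin k, a i * (dMul^[i] f).coeff j := by
  rw [← mulRight_apply, ofFinCoeffs_apply, map_sum, finsetSum_coeff]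
  simp only [mulRight_apply, mulFn_monomial, coeff_C_mul]

theorem coeff_sylvesterMap (m n : ℕ) (f g : DiffOp R) (w : Fin (n + m) → R) (j : Fin (n + m)) :
    (sylvesterMap m n f.toPolynomial g.toPolynomial w).coeff j = Matrix.vecMul w (sylvester m n f g) j := by
  rw [sylvesterMap_apply, coeff_add, coeff_mulFn_ofFinCoeffs, coeff_mulFn_ofFinCoeffs,
    Matrix.vecMul, dotProduct, Fin.sum_univ_add]
  simp only [sylvester, Matrix.of_apply, Fin.append_left, Fin.append_right, coeffVec, D_pow_mul]
  rfl

theorem degree_sylvesterMap_lt [IsDomain R] {m n : ℕ} {f g : R[X]} (hf : f.degree = m)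
    (hg : g.degree = n) (w : Fin (n + m) → R) :
    (sylvesterMap m n f g w).degree < (n + m : ℕ) := by
  rw [sylvesterMap_apply]
  refine (degree_add_le _ _).trans_lt (max_lt ?_ ?_)
  · rw [degree_mulFn, hf, Nat.cast_add]
    exact WithBot.add_lt_add_right (by simp) (degree_ofFinCoeffs_lt _)
  · rw [degree_mulFn, hg, add_comm n m, Nat.cast_add]
    exact WithBot.add_lt_add_right (by simp) (degree_ofFinCoeffs_lt _)

theorem degree_le_of_eq_mulFn [IsDomain R] {f u h : R[X]} (hf : f ≠ 0) (hu : f = mulFn u h) :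
    h.degree ≤ f.degree := by
  have hu0 : u ≠ 0 := by
    rintro rfl
    exact hf (hu.trans (mulFn_zero_left h))
  rw [hu, degree_mulFn, degree_eq_natDegree hu0]
  exact le_add_of_nonneg_left (by exact_mod_cast Nat.zero_le _)

theorem sylvesterMap_eq_zero_iff [IsDomain R] {m n : ℕ} {f g : DiffOp R} (hf : f.degree = m)
    (hg : g.degree = n) (w : Fin (n + m) → R) :
    sylvesterMap m n f.toPolynomial g.toPolynomial w = 0 ↔ Matrix.vecMul w (sylvester m n f g) = 0 := by
  constructor
  · intro h
    ext j
    rw [← coeff_sylvesterMap, h, coeff_zero, Pi.zero_apply]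
  · intro h
    ext j
    by_cases hj : j < n + m
    · rw [show j = ((⟨j, hj⟩ : Fin (n + m)) : ℕ) from rfl, coeff_sylvesterMap, h, coeff_zero,
        Pi.zero_apply]
    · rw [coeff_zero]
      exact coeff_eq_zero_of_degree_lt
        ((degree_sylvesterMap_lt hf hg w).trans_le (by exact_mod_cast not_lt.1 hj))

end CommRing

/-! ### Range and kernel of the Sylvester map. -/

section Field

variable {K : Type*} [Field K] [Differential K]

theorem exists_left_common_multiple {m n : ℕ} {f g : K[X]} (hf : f.degree = m)
    (hg : g.degree = n) :
    ∃ u v : K[X], u ≠ 0 ∧ u.degree ≤ n ∧ mulFn u f + mulFn v g = 0 := by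
  have hg0 : g ≠ 0 := by rintro rfl; simp at hg
  have hle : ∀ w, sylvesterMap (m + 1) (n + 1) f g w ∈ degreeLT K (n + m + 1) := by
    intro w
    rw [mem_degreeLT, sylvesterMap_apply]
    refine (degree_add_le _ _).trans_lt (max_lt ?_ ?_)
    · rw [degree_mulFn, hf, show n + m + 1 = n + 1 + m by ring, Nat.cast_add (n + 1)]
      exact WithBot.add_lt_add_right (by simp) (degree_ofFinCoeffs_lt _)
    · rw [degree_mulFn, hg, show n + m + 1 = m + 1 + n by ring, Nat.cast_add (m + 1)]
      exact WithBot.add_lt_add_right (by simp) (degree_ofFinCoeffs_lt _)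
  -- Cofactors with `deg u ≤ n` and `deg v ≤ m` have `n + m + 2` coefficients, while `uf + vg` has
  -- only `n + m + 1`.
  obtain ⟨w, hw, hw0⟩ := Submodule.exists_mem_ne_zero_of_ne_bot
    (LinearMap.ker_ne_bot_of_finrank_lt
      (f := (sylvesterMap (m + 1) (n + 1) f g).codRestrict _ hle)
      (by rw [(degreeLTEquiv K _).finrank_eq, Module.finrank_fin_fun, Module.finrank_fin_fun]
          omega))
  rw [LinearMap.ker_codRestrict, LinearMap.mem_ker, sylvesterMap_apply] at hw
  refine ⟨_, _, ?_, ?_, hw⟩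
  · intro hu
    rw [hu, mulFn_zero_left, zero_add, mulFn_eq_zero, or_iff_left hg0] at hw
    apply hw0
    have hu' := (injective_iff_map_eq_zero _).1 (ofFinCoeffs_injective _) _ hu
    have hv' := (injective_iff_map_eq_zero _).1 (ofFinCoeffs_injective _) _ hw
    ext i
    refine Fin.addCases (fun i => ?_) (fun i => ?_) i
    · exact congrFun hu' i
    · exact congrFun hv' i
  · exact Order.lt_succ_iff.1 (degree_ofFinCoeffs_lt _)

theorem range_sylvesterMap {m n e : ℕ} {f g h a b : K[X]} (hf : f.degree = m)
    (hg : g.degree = n) (hh : h.degree = e) (hab : h = mulFn a f + mulFn b g)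
    (hhf : ∃ u, f = mulFn u h) (hhg : ∃ v, g = mulFn v h) :
    LinearMap.range (sylvesterMap m n f g) =
      (degreeLT K (n + m - e)).map (mulRight h) := by
  -- This makes the natural-number subtraction `n + m - e` a true one.
  have hem : e ≤ m := by
    obtain ⟨u, hu⟩ := hhf
    have := degree_le_of_eq_mulFn (by rintro rfl; simp at hf) hu
    rw [hh, hf] at this
    exact_mod_cast this
  apply le_antisymm
  · rintro _ ⟨w, rfl⟩
    have hlt := degree_sylvesterMap_lt hf hg w
    obtain ⟨u, hu⟩ := hhf
    obtain ⟨v, hv⟩ := hhg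
    obtain ⟨p, hp⟩ : ∃ p, sylvesterMap m n f g w = mulFn p h := by
      rw [sylvesterMap_apply]
      exact ⟨_, by rw [hu, hv, ← mulFn_assoc, ← mulFn_assoc, ← mulFn_add_left]⟩
    rw [hp, degree_mulFn, hh] at hlt
    refine ⟨p, mem_degreeLT.2 ?_, hp.symm⟩
    rw [show n + m = n + m - e + e by omega, Nat.cast_add (n + m - e)] at hlt
    exact lt_of_add_lt_add_right hlt
  · rintro _ ⟨p, hp, rfl⟩
    have hp := mem_degreeLT.1 hp
    -- The cofactors in `ph = (pa)f + (pb)g` may be too large. Since `uf = -vg`, dividing `pa` by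
    -- `u` moves the quotient part to the `g` side and leaves a remainder of degree below `deg u ≤
    -- n`.
    obtain ⟨u, v, hu, hun, huv⟩ := exists_left_common_multiple hf hg
    obtain ⟨q, r, hqr, hr⟩ := exists_mulFn_add_eq (mulFn p a) hu
    have hdecomp : mulFn p h = mulFn r f + mulFn (mulFn p b - mulFn q v) g := by
      have h1 : mulFn (mulFn q u) f + mulFn (mulFn q v) g = 0 := by
        rw [mulFn_assoc, mulFn_assoc, ← mulFn_add_right, huv, mulFn_zero_right]
      rw [hab, mulFn_add_right, ← mulFn_assoc, ← mulFn_assoc, hqr, mulFn_add_left,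
        mulFn_sub_left, eq_neg_of_add_eq_zero_left h1]
      abel
    set s := mulFn p b - mulFn q v
    have hrn : r.degree < n := hr.trans_le hun
    -- The formula for `s` gives no bound; instead `sg = ph - rf`, where both terms have degree
    -- below `m + n`.
    have hsm : s.degree < m := by
      have hsg : (mulFn s g).degree < (m + n : ℕ) := by
        rw [eq_sub_of_add_eq' hdecomp.symm]
        refine (degree_sub_le _ _).trans_lt (max_lt ?_ ?_)
        · rw [degree_mulFn, hh, show m + n = n + m - e + e by omega, Nat.cast_add (n + m - e)]
          exact WithBot.add_lt_add_right (by simp) hp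
        · rw [degree_mulFn, hf, add_comm m n, Nat.cast_add]
          exact WithBot.add_lt_add_right (by simp) hrn
      rw [degree_mulFn, hg, Nat.cast_add] at hsg
      exact lt_of_add_lt_add_right hsg
    obtain ⟨x, hx⟩ := exists_ofFinCoeffs_eq hrn
    obtain ⟨y, hy⟩ := exists_ofFinCoeffs_eq hsm
    exact ⟨Fin.append x y, by rw [sylvesterMap_append, hx, hy, mulRight_apply, hdecomp]⟩

theorem leftNullspace_sylvester {m n : ℕ} {f g : DiffOp K} (hf : f.degree = m)
    (hg : g.degree = n) :
    leftNullspace (sylvester m n f g) = LinearMap.ker (sylvesterMap m n f.toPolynomial g.toPolynomial) := by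
  ext w
  rw [LinearMap.mem_ker, sylvesterMap_eq_zero_iff hf hg]
  rfl

theorem finrank_leftNullspace_sylvester {m n e : ℕ} {f g : DiffOp K} {h a b : K[X]}
    (hf : f.degree = m) (hg : g.degree = n) (hh : h.degree = e)
    (hab : h = mulFn a f.toPolynomial + mulFn b g.toPolynomial) (hhf : ∃ u, f.toPolynomial = mulFn u h) (hhg : 
    ∃ v, g.toPolynomial = mulFn v h) :
    Module.finrank K (leftNullspace (sylvester m n f g)) = e := by
  have hh0 : h ≠ 0 := by rintro rfl; simp at hh
  have hfin := LinearEquiv.finrank_eq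
    (Submodule.equivMapOfInjective _ (mulRight_injective hh0) (degreeLT K (n + m - e)))
  have he : e ≤ m := by
    obtain ⟨u, hu⟩ := hhf
    have := degree_le_of_eq_mulFn (f := f.toPolynomial) (ne_zero_of_degree_eq hf) hu
    rw [hh, show f.toPolynomial.degree = m from hf] at this
    exact_mod_cast this
  have key := (sylvesterMap m n f.toPolynomial g.toPolynomial).finrank_range_add_finrank_ker
  rw [range_sylvesterMap (f := f.toPolynomial) (g := g.toPolynomial) hf hg hh hab hhf hhg,
    ← hfin,
    (degreeLTEquiv K _).finrank_eq, Module.finrank_fin_fun, Module.finrank_fin_fun] at key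
  rw [leftNullspace_sylvester hf hg]
  omega

end Field

end DiffOp

namespace DiffOp

/-! ### Greatest common right divisors and the nullspace. -/

section Field

variable {K : Type*} [Field K] [Differential K]

/-- A common right divisor of `f` and `g` also divides the combination `k`, which bounds its degree;
maximality of `h` gives the other inequality. -/
theorem IsGCRD.degree_eq_of_bezout {f g h : DiffOp K} (hf : f ≠ 0) (hgcrd : IsGCRD f g h)
    {k a b : DiffOp K} (hk : k = a * f + b * g) (hkf : RightDvd k f) (hkg : RightDvd k g) :
    h.degree = k.degree := by
  refine le_antisymm ?_ (hgcrd.2.2 k hkf hkg)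
  have hk0 : k ≠ 0 := by
    rintro rfl
    obtain ⟨u, hu⟩ := hkf
    exact hf (hu.trans (mul_zero u))
  obtain ⟨⟨u, hu⟩, ⟨v, hv⟩, -⟩ := hgcrd
  have : k = (a * u + b * v) * h := by
    rw [add_mul, mul_assoc, mul_assoc, ← hu, ← hv, hk]
  exact degree_le_of_eq_mulFn (f := k.toPolynomial) (h := h.toPolynomial) hk0 this

theorem exists_isGCRD {f : DiffOp K} (hf : f ≠ 0) (g : DiffOp K) : ∃ h, IsGCRD f g h := by
  obtain ⟨h, a, b, hh, hab, hhf, hhg⟩ :=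
    exists_bezout (f := f.toPolynomial) hf g.toPolynomial
  refine ⟨h, hhf, hhg, ?_⟩
  rintro k ⟨u, hu⟩ ⟨v, hv⟩
  have : (h : DiffOp K) = (show DiffOp K from a) * f + (show DiffOp K from b) * g := hab
  rw [hu, hv, ← mul_assoc, ← mul_assoc, ← add_mul] at this
  exact degree_le_of_eq_mulFn (h := k.toPolynomial) hh this

theorem IsGCRD.degree_eq_finrank {m n : ℕ} {f g h : DiffOp K} (hgcrd : IsGCRD f g h)
    (hf : f.degree = m) (hg : g.degree = n) :
    h.degree = (Module.finrank K (leftNullspace (sylvester m n f g)) : ℕ) := by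
  have hf0 : f.toPolynomial ≠ 0 := ne_zero_of_degree_eq hf
  obtain ⟨k, a, b, hk, hab, hkf, hkg⟩ := exists_bezout hf0 g.toPolynomial
  rw [finrank_leftNullspace_sylvester hf hg (degree_eq_natDegree hk) hab hkf hkg,
    hgcrd.degree_eq_of_bezout hf0 (k := k) hab hkf hkg]
  exact degree_eq_natDegree hk

theorem ofCoeffs_mul_add_eq_zero {m n : ℕ} {f g : DiffOp K} (hf : f.degree = m)
    (hg : g.degree = n) {w : Fin (n + m) → K} (hw : Matrix.vecMul w (sylvester m n f g) = 0) :
    ofCoeffs (fun i : Fin n => w (Fin.castAdd m i)) * f +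
      ofCoeffs (fun i : Fin m => w (Fin.natAdd n i)) * g = 0 := by
  rw [ofCoeffs_eq, ofCoeffs_eq]
  exact (sylvesterMap_eq_zero_iff hf hg w).2 hw

end Field

/-! ### Change of coefficient ring and degrees of the matrix entries. -/

theorem dMul_iterate_map {R S : Type*} [CommRing R] [Differential R] [CommRing S]
    [Differential S] (φ : R →+* S) (hφ : ∀ a, (φ a)′ = φ (a′)) (i : ℕ) (f : R[X]) :
    dMul^[i] (f.map φ) = (dMul^[i] f).map φ := by
  induction i with
  | zero => rfl
  | succ i ih =>
    rw [Function.iterate_succ_apply', ih, Function.iterate_succ_apply']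
    ext j
    cases j with
    | zero => simp only [coeff_map, coeff_dMul_zero, hφ]
    | succ j => simp only [coeff_map, coeff_dMul_succ, hφ, map_add]

theorem sylvester_map {R S : Type*} [CommRing R] [Differential R] [CommRing S]
    [Differential S] (φ : R →+* S) (hφ : ∀ a, (φ a)′ = φ (a′)) (m n : ℕ) (f g : DiffOp R) :
    sylvester m n (map φ f) (map φ g) = (sylvester m n f g).map φ := by
  have key : ∀ (i j : ℕ) (f : DiffOp R),
      (D S ^ i * map φ f).coeff j = φ ((D R ^ i * f).coeff j) := by
    intro i j f
    rw [D_pow_mul, D_pow_mul]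
    change (dMul^[i] (f.toPolynomial.map φ)).coeff j = _
    rw [dMul_iterate_map φ hφ, coeff_map]
    rfl
  ext i j
  refine Fin.addCases (fun i => ?_) (fun i => ?_) i <;>
  simp only [sylvester, Matrix.map_apply, Matrix.of_apply, Fin.append_left, Fin.append_right,
    coeffVec, key]

/-- A coefficient of `∂f` is a sum of a coefficient of `f` and a derivative of one, so the bound
does not grow with `i`. -/
theorem natDegree_coeff_dMul_iterate_le {F : Type*} [Field F] {f : F[X][X]} {d : ℕ}
    (hf : ∀ j, (f.coeff j).natDegree ≤ d) (i j : ℕ) :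
    ((dMul^[i] f).coeff j).natDegree ≤ d := by
  have hder : ∀ p : F[X], p.natDegree ≤ d → (p′).natDegree ≤ d := fun p hp =>
    (natDegree_derivative_le p).trans (by omega)
  induction i generalizing j with
  | zero => exact hf j
  | succ i ih =>
    rw [Function.iterate_succ_apply']
    cases j with
    | zero =>
      rw [coeff_dMul_zero]
      exact hder _ (ih _)
    | succ j =>
      rw [coeff_dMul_succ]
      exact natDegree_add_le_of_degree_le (ih _) (hder _ (ih _))

theorem natDegree_sylvester_le {F : Type*} [Field F] {f g : DiffOp F[X]} {d : ℕ}
    (hf : ∀ j, (f.coeff j).natDegree ≤ d) (hg : ∀ j, (g.coeff j).natDegree ≤ d) (m n : ℕ)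
    (i j : Fin (n + m)) : (sylvester m n f g i j).natDegree ≤ d := by
  refine Fin.addCases (fun i => ?_) (fun i => ?_) i <;>
  simp only [sylvester, Matrix.of_apply, Fin.append_left, Fin.append_right, coeffVec, D_pow_mul]
  · exact natDegree_coeff_dMul_iterate_le (f := f.toPolynomial) hf _ _
  · exact natDegree_coeff_dMul_iterate_le (f := g.toPolynomial) hg _ _

end DiffOp

/-! ### Compatibility of derivations, small null vectors, and the theorem. -/

theorem RatFuncDeriv.deriv_algebraMap {F : Type*} [Field F] (p : F[X]) :
    (algebraMap F[X] (RatFunc F) p)′ = algebraMap F[X] (RatFunc F) (p′) := by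
  have h := fn_div p 1 one_ne_zero
  simp only [map_one, div_one, derivative_one, map_zero, mul_zero, sub_zero, mul_one,
    one_pow] at h
  exact h

/-- A singular square matrix of polynomials of degree at most `d` has a nonzero left null vector
whose entries have degree at most `N * d`, where `N` is the size of the matrix. -/
theorem exists_vecMul_eq_zero_natDegree_le {F ι : Type*} [Field F] [Fintype ι] [DecidableEq ι]
    {A : Matrix ι ι F[X]} {d : ℕ} (hA : ∀ i j, (A i j).natDegree ≤ d) (hdet : A.det = 0) :
    ∃ w : ι → F[X], w ≠ 0 ∧ Matrix.vecMul w A = 0 ∧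
      ∀ i, (w i).natDegree ≤ Fintype.card ι * d := by
  obtain ⟨x, hx, hAx⟩ := Matrix.exists_mulVec_eq_zero_iff.2 hdet
  obtain ⟨j₀, hj₀⟩ := Function.ne_iff.1 hx
  -- Only the columns `j ≠ j₀` are imposed as equations; column `j₀`, where `x` is nonzero, will
  -- follow from `Ax = 0`. No degree bound on `x` is needed.
  set N := Fintype.card ι
  let L : (ι → degreeLT F (N * d + 1)) →ₗ[F] ({j // j ≠ j₀} → F[X]) :=
    LinearMap.pi fun j => ∑ i, LinearMap.mulRight F (A i j) ∘ₗ (degreeLT F (N * d + 1)).subtype ∘ₗ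
      LinearMap.proj i
  have hL : ∀ w j, L w j = Matrix.vecMul (fun i => (w i : F[X])) A j := by
    intro w j
    simp [L, Matrix.vecMul, dotProduct]
  have hLdeg : ∀ w j, L w j ∈ degreeLT F (N * d + d + 1) := by
    intro w j
    rw [hL, Matrix.vecMul, dotProduct]
    refine Submodule.sum_mem _ fun i _ => ?_
    rw [mem_degreeLT]
    have hwi : (w i : F[X]).degree ≤ (N * d : ℕ) :=
      Order.lt_succ_iff.1 (mem_degreeLT.1 (w i).2)
    have hprod := degree_mul_le_of_le hwi (natDegree_le_iff_degree_le.1 (hA i j))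
    rw [← Nat.cast_add] at hprod
    exact Order.lt_succ_iff.2 hprod
  let L' : (ι → degreeLT F (N * d + 1)) →ₗ[F] ({j // j ≠ j₀} → degreeLT F (N * d + d + 1)) :=
    LinearMap.pi fun j => (LinearMap.proj j ∘ₗ L).codRestrict _ fun w => hLdeg w j
  have hN : 0 < N := Fintype.card_pos_iff.2 ⟨j₀⟩
  -- Over `F` there are `N(Nd + 1)` unknowns and `(N - 1)(Nd + d + 1) = N(Nd + 1) - d - 1`
  -- equations.
  obtain ⟨w, hw, hw0⟩ := Submodule.exists_mem_ne_zero_of_ne_bot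
    (LinearMap.ker_ne_bot_of_finrank_lt (f := L') (by
      rw [Module.finrank_pi_fintype, Module.finrank_pi_fintype]
      simp only [(degreeLTEquiv F _).finrank_eq, Module.finrank_fin_fun, Finset.sum_const,
        Finset.card_univ, smul_eq_mul, Fintype.card_subtype_compl, Fintype.card_subtype_eq]
      change (N - 1) * _ < N * _
      obtain ⟨M, hM⟩ : ∃ M, N = M + 1 := ⟨N - 1, by omega⟩
      rw [hM, Nat.add_sub_cancel]
      nlinarith))
  have hzero : ∀ j, j ≠ j₀ → Matrix.vecMul (fun i => (w i : F[X])) A j = 0 := by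
    intro j hj
    rw [← hL w ⟨j, hj⟩]
    exact congrArg Subtype.val (congrFun (LinearMap.mem_ker.1 hw) ⟨j, hj⟩)
  refine ⟨fun i => w i, ?_, ?_, ?_⟩
  · intro h0
    exact hw0 (funext fun i => Subtype.ext (congrFun h0 i))
  -- In `(wA)·x = w·(Ax) = 0` only the term at `j₀` survives, and `F[X]` is a domain.
  · have hdot : Matrix.vecMul (fun i => (w i : F[X])) A ⬝ᵥ x = 0 := by
      rw [← Matrix.dotProduct_mulVec, hAx, dotProduct_zero]
    rw [dotProduct, Finset.sum_eq_single j₀ (fun j _ hj => by rw [hzero j hj, zero_mul])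
      (by simp)] at hdot
    ext1 j
    by_cases hj : j = j₀
    · rw [hj]
      exact (mul_eq_zero.1 hdot).resolve_right hj₀
    · exact hzero j hj
  · intro i
    exact natDegree_le_iff_degree_le.2 (Order.lt_succ_iff.1 (mem_degreeLT.1 (w i).2))

theorem lemma2 (f g : DiffOp ℝ[X]) (m n d : ℕ)
    (hf : f.degree = m) (hg : g.degree = n)
    (hfd : ∀ i, (f.coeff i).natDegree ≤ d) (hgd : ∀ i, (g.coeff i).natDegree ≤ d) :
    (∃ h, DiffOp.IsGCRD (toRatOp f) (toRatOp g) h) ∧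
    (∀ h, DiffOp.IsGCRD (toRatOp f) (toRatOp g) h →
      ((DiffOp.sylvester m n f g).det = 0 ↔ 1 ≤ h.degree) ∧
      h.degree = (Module.finrank (RatFunc ℝ) (leftNullspace
        ((DiffOp.sylvester m n f g).map (algebraMap ℝ[X] (RatFunc ℝ)))) : ℕ) ∧
      (1 ≤ h.degree → ∃ w : Fin (n + m) → ℝ[X], w ≠ 0 ∧
        Matrix.vecMul w (DiffOp.sylvester m n f g) = 0 ∧
        ∀ i, (w i).natDegree ≤ 2 * (m + n) * d)) ∧
    (∀ w : Fin (n + m) → RatFunc ℝ,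
      Matrix.vecMul w ((DiffOp.sylvester m n f g).map (algebraMap ℝ[X] (RatFunc ℝ))) = 0 →
      DiffOp.ofCoeffs (fun i : Fin n => w (Fin.castAdd m i)) * toRatOp f +
        DiffOp.ofCoeffs (fun i : Fin m => w (Fin.natAdd n i)) * toRatOp g = 0) := by
  have hinj := RatFunc.algebraMap_injective ℝ
  have hdeg : ∀ p : DiffOp ℝ[X], (toRatOp p).degree = p.degree := fun p =>
    degree_map_eq_of_injective hinj p.toPolynomial
  have hf' : (toRatOp f).degree = m := (hdeg f).trans hf
  have hg' : (toRatOp g).degree = n := (hdeg g).trans hg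
  rw [← DiffOp.sylvester_map _ RatFuncDeriv.deriv_algebraMap]
  refine ⟨DiffOp.exists_isGCRD (DiffOp.ne_zero_of_degree_eq hf') _, fun h hh => ?_, fun w hw =>
    DiffOp.ofCoeffs_mul_add_eq_zero hf' hg' hw⟩
  have hrank := hh.degree_eq_finrank hf' hg'
  have hsing : (DiffOp.sylvester m n f g).det = 0 ↔ 1 ≤ h.degree := by
    -- Both sides become the existence of a nonzero left null vector over the field of rational
    -- functions; the determinant is carried there by the injective inclusion.
    rw [hrank, Nat.one_le_cast, Nat.one_le_iff_ne_zero, Ne, Submodule.finrank_eq_zero,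
      ← map_eq_zero_iff _ hinj, RingHom.map_det, ← Matrix.exists_vecMul_eq_zero_iff,
      RingHom.mapMatrix_apply, ← DiffOp.sylvester_map _ RatFuncDeriv.deriv_algebraMap,
      ← Ne, Submodule.ne_bot_iff]
    exact exists_congr fun w => and_comm
  refine ⟨hsing, hrank, fun h1 => ?_⟩
  obtain ⟨w, hw0, hw, hwd⟩ := exists_vecMul_eq_zero_natDegree_le
    (DiffOp.natDegree_sylvester_le hfd hgd m n) (hsing.2 h1)
  refine ⟨w, hw0, hw, fun i => (hwd i).trans ?_⟩
  -- The count gives `(n + m)d`, so the factor 2 is slack.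
  rw [Fintype.card_fin]
  gcongr
  omega
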